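/- A groupoid is a set with one binary operation, written as juxtaposition. A Latin square is a groupoid in which, for all elements $a,b$, there are unique elements $c,d$ with $ac=b$ and $da=b$. Let $\langle S,\vee\rangle$ be a join semilattice, ordered by $s\le t\iff s\vee t=t$; let $(A_s)_{s\in S}$ be nonempty groupoids, and for $s\le t$ let $\phi_{s,t}\colon A_s\to A_t$ be homomorphisms with $\phi_{s,s}=\mathrm{id}_{A_s}$ and $\phi_{t,u}\circ\phi_{s,t}=\phi_{s,u}$ whenever $s\le t\le u$. The Płonka sum of this system is the disjoint union of the sets $A_s$ with the operation $$x\cdot y=\phi_{s,\,s\vee t}(x)\cdot\phi_{t,\,s\vee t}(y)\qquad(x\in A_s,\ y\in A_t),$$ where the product on the right is taken in $A_{s\vee t}$. **Theorem.** Let $A$ be a finite groupoid that is commutative ($xy=yx$), idempotent ($xx=x$) and self-distributive ($x(yz)=(xy)(xz)$). Then $A$ is isomorphic to the Płonka sum of a system of groupoids as above in which every $A_s$ is a Latin square. -/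

import Mathlib

universe u v

/-- A groupoid (a set with one binary operation) that is commutative, idempotent and
self-distributive. -/
structure IsCIDGroupoid (A : Type u) [Mul A] : Prop where
  comm : ∀ x y : A, x * y = y * x
  idem : ∀ x : A, x * x = x
  distrib : ∀ x y z : A, x * (y * z) = (x * y) * (x * z)

/-- A Latin square: a groupoid in which both `a * c = b` and `d * a = b` are uniquely solvable. -/
def IsLatinSquare (A : Type u) [Mul A] : Prop :=
  ∀ a b : A, (∃! c : A, a * c = b) ∧ (∃! d : A, d * a = b)

/-- A system of (nonempty) groupoids indexed by a join semilattice, with homomorphisms along the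
order that are functorial. -/
structure PlonkaSystem (S : Type u) [SemilatticeSup S] where
  /-- The fibers. -/
  Fiber : S → Type v
  /-- The groupoid operation on each fiber. -/
  fiberMul : ∀ s, Mul (Fiber s)
  /-- Algebras have nonempty universes. -/
  fiber_nonempty : ∀ s, Nonempty (Fiber s)
  /-- The fiber maps. -/
  map : ∀ {s t : S}, s ≤ t → (Fiber s →ₙ* Fiber t)
  map_refl : ∀ (s : S) (x : Fiber s), map (le_refl s) x = x
  map_map : ∀ {s t r : S} (hst : s ≤ t) (htr : t ≤ r) (x : Fiber s),
    map htr (map hst x) = map (hst.trans htr) x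

namespace PlonkaSystem

variable {S : Type u} [SemilatticeSup S]

instance (P : PlonkaSystem.{u, v} S) (s : S) : Mul (P.Fiber s) := P.fiberMul s

/-- The universe of the Płonka sum: the disjoint union of the fibers. -/
def Sum (P : PlonkaSystem.{u, v} S) : Type (max u v) := Σ s : S, P.Fiber s

/-- The operation of the Płonka sum: for `x` in the fiber over `s` and `y` in the fiber over `t`,
send both to the fiber over `s ⊔ t` and multiply there. -/
instance (P : PlonkaSystem.{u, v} S) : Mul P.Sum where
  mul x y := ⟨x.1 ⊔ y.1, P.map le_sup_left x.2 * P.map le_sup_right y.2⟩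

end PlonkaSystem

/-- The groupoid `A` is (isomorphic to) a Płonka sum of Latin squares, over an index semilattice
and with fibers in the universe of `A`. -/
def IsPlonkaSumOfLatinSquares (A : Type u) [Mul A] : Prop :=
  ∃ (S : Type u) (_ : SemilatticeSup S) (P : PlonkaSystem.{u, u} S),
    (∀ s : S, IsLatinSquare (P.Fiber s)) ∧ Nonempty (A ≃* P.Sum)

/-! Write `L_x` for left translation, an endomorphism by distributivity. By finiteness one `n` makes
every `e_x = L_x^n` idempotent. The crux is `mul_left_injOn_range`: `L_x` is injective on its range,
so `e_x` fixes that range pointwise. Hence `e_x ∘ e_y = e_{xy}` (`iteratedTranslation_comp`), and `x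
↦ e_x` maps `A` homomorphically onto a semilattice of maps. Its fibers are the summands and the maps
`e_x` themselves are the transition maps. If `e_a = e_c` then `e_a c = e_c c = c`, so `L_a` is
cancellable on its fiber, which is finite and hence a Latin square. -/

theorem exists_pow_isIdempotentElem {M : Type*} [Monoid M] [Finite M] (a : M) :
    ∃ n : ℕ, 0 < n ∧ IsIdempotentElem (a ^ n) := by
  obtain ⟨i, j, hne, hij⟩ := Finite.exists_ne_map_eq_of_infinite (fun n : ℕ => a ^ n)
  wlog hlt : i < j generalizing i j
  · exact this j i hne.symm hij.symm (by omega)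
  obtain ⟨d, rfl⟩ := Nat.exists_eq_add_of_lt hlt
  have hperiod : ∀ k n, i ≤ n → a ^ (n + k * (d + 1)) = a ^ n := by
    intro k
    induction k with
    | zero => simp
    | succ k ih =>
      intro n hn
      obtain ⟨c, rfl⟩ := Nat.exists_eq_add_of_le hn
      have h1 : i + c + (k + 1) * (d + 1) = (i + d + 1) + (c + k * (d + 1)) := by ring
      have h2 : i + (c + k * (d + 1)) = i + c + k * (d + 1) := by ring
      have hij' : a ^ i = a ^ (i + d + 1) := hij
      rw [h1, pow_add, ← hij', ← pow_add, h2, ih _ hn]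
  -- A multiple of the period `d + 1` that is at least `i`, and positive even if `i = 0`.
  refine ⟨(i + 1) * (d + 1), by positivity, ?_⟩
  rw [IsIdempotentElem, ← pow_add]
  exact hperiod (i + 1) _ (by nlinarith)

/-- Left translation `z ↦ x * z`. -/
def leftTranslation {A : Type*} [Mul A] (x : A) : A → A := fun z => x * z

/-- The `n`-fold left translation `z ↦ x * (x * ⋯ (x * z))`. -/
def iteratedTranslation {A : Type*} [Mul A] (n : ℕ) (x : A) : A → A := (leftTranslation x)^[n]

/-- The exponent `n` is positive and all `n`-fold left translations are idempotent maps. -/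
structure IsRetractionExponent (A : Type*) [Mul A] (n : ℕ) : Prop where
  pos : 0 < n
  retract : ∀ x z : A, iteratedTranslation n x (iteratedTranslation n x z) =
    iteratedTranslation n x z

/-- Taking an idempotent power in the finite monoid of all families of self-maps makes the exponent
uniform in `x`. -/
theorem exists_isRetractionExponent (A : Type*) [Mul A] [Finite A] :
    ∃ n, IsRetractionExponent A n := by
  have key : ∀ (F : A → Function.End A) (n : ℕ) (x : A), (F ^ n) x = (F x)^[n] := by
    intro F n x
    induction n with
    | zero => rfl
    | succ n ih => rw [pow_succ, Pi.mul_apply, ih]; rfl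
  have : Finite (Function.End A) := inferInstanceAs (Finite (A → A))
  obtain ⟨n, hn, hidem⟩ :=
    exists_pow_isIdempotentElem (M := A → Function.End A)
      (show A → Function.End A from leftTranslation)
  refine ⟨n, hn, fun x z => ?_⟩
  have h := congrFun hidem x
  rw [Pi.mul_apply, key] at h
  exact congrFun h z

namespace IsCIDGroupoid

variable {A : Type*} [Mul A]

theorem iteratedTranslation_succ (n : ℕ) (x z : A) :
    iteratedTranslation (n + 1) x z = x * iteratedTranslation n x z :=
  Function.iterate_succ_apply' _ _ _

theorem iteratedTranslation_succ' (n : ℕ) (x z : A) :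
    iteratedTranslation (n + 1) x z = iteratedTranslation n x (x * z) :=
  Function.iterate_succ_apply _ _ _

theorem iteratedTranslation_eq_mul {n : ℕ} (hn : 0 < n) (x z : A) :
    ∃ w, iteratedTranslation n x z = x * w := by
  obtain ⟨m, rfl⟩ := Nat.exists_eq_succ_of_ne_zero hn.ne'
  exact ⟨_, iteratedTranslation_succ m x z⟩

theorem iteratedTranslation_mul (hA : IsCIDGroupoid A) (n : ℕ) (x y z : A) :
    iteratedTranslation n x (y * z) = iteratedTranslation n x y * iteratedTranslation n x z := by
  induction n with
  | zero => rfl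
  | succ n ih => rw [iteratedTranslation_succ, ih, hA.distrib, iteratedTranslation_succ,
      iteratedTranslation_succ]

theorem iteratedTranslation_self (hA : IsCIDGroupoid A) (n : ℕ) (x : A) :
    iteratedTranslation n x x = x := by
  induction n with
  | zero => rfl
  | succ n ih => rw [iteratedTranslation_succ, ih, hA.idem]

/-- A multiplicative map carries iterated translations to iterated translations. -/
theorem map_iteratedTranslation {B : Type*} [Mul B] (g : A → B) (hg : ∀ y z, g (y * z) = g y * g z)
    (n : ℕ) (y z : A) :
    g (iteratedTranslation n y z) = iteratedTranslation n (g y) (g z) := by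
  induction n with
  | zero => rfl
  | succ n ih => simp only [iteratedTranslation_succ, ih, hg]

theorem iteratedTranslation_iteratedTranslation (hA : IsCIDGroupoid A) (m n : ℕ) (x y z : A) :
    iteratedTranslation m x (iteratedTranslation n y z) =
      iteratedTranslation n (iteratedTranslation m x y) (iteratedTranslation m x z) :=
  map_iteratedTranslation _ (hA.iteratedTranslation_mul m x) n y z

theorem mul_iteratedTranslation (hA : IsCIDGroupoid A) (n : ℕ) (x y z : A) :
    x * iteratedTranslation n y z = iteratedTranslation n (x * y) (x * z) :=
  map_iteratedTranslation _ (hA.distrib x) n y z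

/-! ### Cancellation on the range of a translation -/

/-- If some translation is injective, then every translation is injective on its range. -/
theorem mul_left_injOn_of_injective [Finite A] (hA : IsCIDGroupoid A) {p : A}
    (hp : Function.Injective (leftTranslation p)) (x a b : A) (h : x * (x * a) = x * (x * b)) :
    x * a = x * b := by
  have hsurj : Function.Surjective (leftTranslation p) := Finite.surjective_of_injective hp
  -- `(px)(xw) = x(pw)`, and `pw` runs through all of `A`.
  have himage : leftTranslation (p * x) '' Set.range (leftTranslation x) =
      Set.range (leftTranslation x) := by
    ext z
    constructor
    · rintro ⟨_, ⟨w, rfl⟩, rfl⟩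
      exact ⟨p * w, by simp only [leftTranslation]; rw [hA.comm p x, ← hA.distrib]⟩
    · rintro ⟨w, rfl⟩
      obtain ⟨v, rfl⟩ := hsurj w
      exact ⟨_, ⟨v, rfl⟩, by simp only [leftTranslation]; rw [hA.comm p x, ← hA.distrib]⟩
  have hconj : Set.range (leftTranslation (p * x)) =
      leftTranslation p '' Set.range (leftTranslation x) := by
    ext z
    constructor
    · rintro ⟨w, rfl⟩
      obtain ⟨v, rfl⟩ := hsurj w
      exact ⟨_, ⟨v, rfl⟩, hA.distrib p x v⟩
    · rintro ⟨_, ⟨w, rfl⟩, rfl⟩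
      exact ⟨p * w, (hA.distrib p x w).symm⟩
  have hrange : Set.range (leftTranslation x) = Set.range (leftTranslation (p * x)) := by
    refine Set.eq_of_subset_of_ncard_le ?_ ?_
    · rw [← himage]
      exact Set.image_subset_range _ _
    · rw [hconj, Set.ncard_image_of_injective _ hp]
  have hinj : Set.InjOn (leftTranslation (p * x)) (Set.range (leftTranslation x)) :=
    Set.injOn_of_ncard_image_eq (by rw [himage])
  have hmem : ∀ c, p * (x * c) ∈ Set.range (leftTranslation x) := fun c => by
    rw [hrange, hconj]
    exact ⟨_, ⟨c, rfl⟩, rfl⟩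
  refine hp (hinj (hmem a) (hmem b) ?_)
  simp only [leftTranslation]
  rw [← hA.distrib, ← hA.distrib, h]

/-- On the image of the retraction `e_p`, with `p = xa`, translation by `p` is injective because its
`n`-th power is the identity. The previous lemma applies there. -/
theorem iteratedTranslation_eq_of_mul_eq [Finite A] (hA : IsCIDGroupoid A) {n : ℕ}
    (hn : IsRetractionExponent A n) (x a b : A) (h : x * (x * a) = x * (x * b)) :
    iteratedTranslation n (x * a) (x * b) = x * a := by
  set p := x * a with hp
  let e : A → A := iteratedTranslation n p
  have he : ∀ y z, e (y * z) = e y * e z := hA.iteratedTranslation_mul n p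
  have hee : ∀ z, e (e z) = e z := hn.retract p
  let B : Type _ := {z : A // e z = z}
  let _ : Mul B := ⟨fun y z => ⟨y.1 * z.1, by rw [he, y.2, z.2]⟩⟩
  have hB : IsCIDGroupoid B :=
    ⟨fun _ _ => Subtype.ext (hA.comm _ _), fun _ => Subtype.ext (hA.idem _),
      fun _ _ _ => Subtype.ext (hA.distrib _ _ _)⟩
  have hpp : e p = p := hA.iteratedTranslation_self n p
  obtain ⟨m, hm⟩ := Nat.exists_eq_succ_of_ne_zero hn.pos.ne'
  have hinj : Function.Injective (leftTranslation (⟨p, hpp⟩ : B)) := by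
    rintro ⟨y, hy⟩ ⟨z, hz⟩ hyz
    have hyz' : p * y = p * z := congrArg Subtype.val hyz
    refine Subtype.ext ?_
    change y = z
    rw [← hy, ← hz]
    change iteratedTranslation n p y = iteratedTranslation n p z
    rw [hm, iteratedTranslation_succ', hyz', ← iteratedTranslation_succ']
  have hcancel := hB.mul_left_injOn_of_injective hinj ⟨e x, hee x⟩ ⟨e a, hee a⟩ ⟨e b, hee b⟩
    (Subtype.ext (by
      change e x * (e x * e a) = e x * (e x * e b)
      rw [← he, ← he, ← he, ← he, ← hp, h]))
  have hcancel' : e x * e a = e x * e b := congrArg Subtype.val hcancel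
  rw [← he, ← he, ← hp, hpp] at hcancel'
  exact hcancel'.symm

/-- Every translation is injective on its range. -/
theorem mul_left_injOn_range [Finite A] (hA : IsCIDGroupoid A) (x a b : A)
    (h : x * (x * a) = x * (x * b)) : x * a = x * b := by
  obtain ⟨n, hn⟩ := exists_isRetractionExponent A
  -- With `p = xa` and `q = xc`, the product `pq = x(ac)` satisfies the same hypothesis, so
  -- induction gives `pq = p`. Then `e_q p = p`, whereas exchanging `a` and `c` in the previous
  -- lemma gives `e_q p = q`.
  have hstep : ∀ k c, x * (x * a) = x * (x * c) →
      iteratedTranslation k (x * a) (x * c) = x * a → x * c = x * a := by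
    intro k
    induction k with
    | zero => exact fun c _ hc => hc
    | succ k ih =>
      intro c hc hk
      have hprod : (x * a) * (x * c) = x * (a * c) := (hA.distrib x a c).symm
      have hprod' : x * (x * a) = x * (x * (a * c)) := by
        rw [hA.distrib x a c, hA.distrib x (x * a), ← hc, hA.idem]
      rw [iteratedTranslation_succ', hprod] at hk
      have h1 := ih (a * c) hprod' hk
      have h2 := hA.iteratedTranslation_eq_of_mul_eq hn x c a hc.symm
      have h3 : iteratedTranslation n (x * c) (x * a) = x * a := by
        have hfix : (x * c) * (x * a) = x * a := by rw [hA.comm, hprod, h1]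
        exact Function.iterate_fixed hfix n
      exact h2.symm.trans h3
  exact (hstep n b h (hA.iteratedTranslation_eq_of_mul_eq hn x a b h)).symm

/-! ### Composition of the retractions -/

section Retraction

variable {n : ℕ}

theorem iteratedTranslation_apply_mul [Finite A] (hA : IsCIDGroupoid A)
    (hn : IsRetractionExponent A n) (x w : A) : iteratedTranslation n x (x * w) = x * w := by
  have hcancel : ∀ k u v, iteratedTranslation k x (x * u) = iteratedTranslation k x (x * v) →
      x * u = x * v := by
    intro k
    induction k with
    | zero => exact fun _ _ h => h
    | succ k ih =>
      intro u v h
      rw [iteratedTranslation_succ', iteratedTranslation_succ'] at h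
      exact hA.mul_left_injOn_range x u v (ih _ _ h)
  have hcomm : iteratedTranslation n x (x * w) = x * iteratedTranslation n x w := by
    rw [hA.iteratedTranslation_mul, hA.iteratedTranslation_self]
  rw [hcomm]
  refine hcancel n _ _ ?_
  rw [← hcomm, hn.retract]

theorem mul_iteratedTranslation_self [Finite A] (hA : IsCIDGroupoid A)
    (hn : IsRetractionExponent A n) (x z : A) : x * iteratedTranslation n x z = x * z := by
  rw [← iteratedTranslation_succ, iteratedTranslation_succ', hA.iteratedTranslation_apply_mul hn]

/-- Both sides are fixed by `e_{xw}`. Expanded by distributivity, they differ only in the factors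
`w(e_x v) = e_{xw}(wv)` and `wv`, which `e_{xw}` identifies. -/
theorem mul_mul_iteratedTranslation [Finite A] (hA : IsCIDGroupoid A)
    (hn : IsRetractionExponent A n) (x w v : A) :
    (x * w) * iteratedTranslation n x v = (x * w) * v := by
  have hx : x * iteratedTranslation n x v = x * v := hA.mul_iteratedTranslation_self hn x v
  have hw : iteratedTranslation n (x * w) (w * v) = w * iteratedTranslation n x v := by
    rw [hA.mul_iteratedTranslation, hA.comm w x]
  have hfix : ∀ u, iteratedTranslation n (x * w) ((x * w) * u) = (x * w) * u :=
    hA.iteratedTranslation_apply_mul hn (x * w)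
  have hdist : ∀ u, (x * w) * u = (x * u) * (w * u) := fun u => by
    rw [hA.comm _ u, hA.distrib, hA.comm u x, hA.comm u w]
  rw [← hfix v, ← hfix (iteratedTranslation n x v), hdist v, hdist, hx,
    hA.iteratedTranslation_mul n (x * w) (x * v), hA.iteratedTranslation_mul n (x * w) (x * v),
    ← hw, hn.retract]

theorem iteratedTranslation_comp_of_mul [Finite A] (hA : IsCIDGroupoid A)
    (hn : IsRetractionExponent A n) (x w v : A) :
    iteratedTranslation n (x * w) (iteratedTranslation n x v) =
      iteratedTranslation n (x * w) v := by
  obtain ⟨m, hm⟩ := Nat.exists_eq_succ_of_ne_zero hn.pos.ne'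
  have h := hA.mul_mul_iteratedTranslation hn x w v
  generalize iteratedTranslation n x v = u at h ⊢
  rw [hm, iteratedTranslation_succ', h, ← iteratedTranslation_succ']

theorem iteratedTranslation_comp_eq_iteratedTranslation [Finite A] (hA : IsCIDGroupoid A)
    (hn : IsRetractionExponent A n) (x y : A) :
    iteratedTranslation n x ∘ iteratedTranslation n y =
      iteratedTranslation n (iteratedTranslation n x y) := by
  obtain ⟨w, hw⟩ := iteratedTranslation_eq_mul hn.pos x y
  funext z
  rw [Function.comp_apply, hA.iteratedTranslation_iteratedTranslation, hw,
    hA.iteratedTranslation_comp_of_mul hn]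

/-- The retractions compose according to the multiplication. -/
theorem iteratedTranslation_comp [Finite A] (hA : IsCIDGroupoid A)
    (hn : IsRetractionExponent A n) (x y : A) :
    iteratedTranslation n x ∘ iteratedTranslation n y = iteratedTranslation n (x * y) := by
  -- With `d = e_x y`, it remains to see `e_d = e_{xy}`. Since `d` arises from `xy` by translations,
  -- `e_d e_{xy} = e_d`; since `xy = dx`, `e_d` fixes the range of `L_{xy}`, so `e_d e_{xy} =
  -- e_{xy}`.
  have hdown : ∀ k c z, iteratedTranslation n (iteratedTranslation k x c)
      (iteratedTranslation n c z) = iteratedTranslation n (iteratedTranslation k x c) z := by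
    intro k c z
    induction k with
    | zero => exact hn.retract c z
    | succ k ih =>
      rw [iteratedTranslation_succ, hA.comm x, ← hA.iteratedTranslation_comp_of_mul hn, ih,
        hA.iteratedTranslation_comp_of_mul hn]
  obtain ⟨m, hm⟩ := Nat.exists_eq_succ_of_ne_zero hn.pos.ne'
  have hd : iteratedTranslation n x y = iteratedTranslation m x (x * y) := by
    rw [hm, iteratedTranslation_succ']
  have hc : x * y = iteratedTranslation n x y * x := by
    rw [hA.comm _ x, hA.mul_iteratedTranslation_self hn]
  funext z
  have habsorb : ∀ u, iteratedTranslation n (iteratedTranslation n x y) ((x * y) * u) =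
      (x * y) * u := fun u => by
    rw [hc, hA.iteratedTranslation_mul, hA.iteratedTranslation_apply_mul hn,
      hA.mul_mul_iteratedTranslation hn]
  obtain ⟨u, hu⟩ := iteratedTranslation_eq_mul hn.pos (x * y) z
  rw [hA.iteratedTranslation_comp_eq_iteratedTranslation hn]
  calc iteratedTranslation n (iteratedTranslation n x y) z
      = iteratedTranslation n (iteratedTranslation n x y) (iteratedTranslation n (x * y) z) := by
        rw [hd, hdown]
    _ = iteratedTranslation n (x * y) z := by rw [hu, habsorb]

/-! ### The Płonka system -/

/-- The semilattice of retractions, with composition as join. -/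
@[reducible] def retractionSemilattice [Finite A] (hA : IsCIDGroupoid A)
    (hn : IsRetractionExponent A n) :
    SemilatticeSup (Set.range (iteratedTranslation n : A → A → A)) :=
  @SemilatticeSup.mk' _
    ⟨fun s t => ⟨s.1 ∘ t.1, by
      obtain ⟨_, x, rfl⟩ := s
      obtain ⟨_, y, rfl⟩ := t
      exact ⟨x * y, (hA.iteratedTranslation_comp hn x y).symm⟩⟩⟩
    (by
      rintro ⟨_, x, rfl⟩ ⟨_, y, rfl⟩
      refine Subtype.ext ?_
      change iteratedTranslation n x ∘ iteratedTranslation n y =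
        iteratedTranslation n y ∘ iteratedTranslation n x
      rw [hA.iteratedTranslation_comp hn, hA.iteratedTranslation_comp hn, hA.comm])
    (fun _ _ _ => rfl)
    (by
      rintro ⟨_, x, rfl⟩
      exact Subtype.ext (funext (hn.retract x)))

/-- The elements inducing a given map by iterated translation. -/
abbrev RetractionFiber (n : ℕ) {A : Type*} [Mul A] (s : A → A) : Type _ :=
  {x : A // iteratedTranslation n x = s}

/-- The elements inducing a given retraction are closed under multiplication. -/
@[reducible] def retractionFiberMul [Finite A] (hA : IsCIDGroupoid A)
    (hn : IsRetractionExponent A n) (s : Set.range (iteratedTranslation n : A → A → A)) :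
    Mul (RetractionFiber n s.1) :=
  ⟨fun x y => ⟨x.1 * y.1, by
    obtain ⟨_, b, rfl⟩ := s
    rw [← hA.iteratedTranslation_comp hn, x.2, y.2]
    exact funext (hn.retract b)⟩⟩

theorem eq_of_mul_eq_of_iteratedTranslation_eq (hn : 0 < n) {a c d : A}
    (hc : iteratedTranslation n a c = c) (hd : iteratedTranslation n a d = d)
    (h : a * c = a * d) : c = d := by
  obtain ⟨m, rfl⟩ := Nat.exists_eq_succ_of_ne_zero hn.ne'
  rw [← hc, ← hd, iteratedTranslation_succ', iteratedTranslation_succ', h]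

theorem iteratedTranslation_eq_of_mem_fiber (hA : IsCIDGroupoid A) {a c : A}
    (h : iteratedTranslation n a = iteratedTranslation n c) : iteratedTranslation n a c = c := by
  rw [h, hA.iteratedTranslation_self]

/-- The elements inducing a given retraction, as fibers over the semilattice of retractions. -/
def plonkaSystem {A : Type u} [Mul A] [Finite A] (hA : IsCIDGroupoid A)
    (hn : IsRetractionExponent A n) :
    @PlonkaSystem.{u, u} (Set.range (iteratedTranslation n : A → A → A))
      (hA.retractionSemilattice hn) :=
  letI := hA.retractionSemilattice hn
  letI := hA.retractionFiberMul hn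
  { Fiber := fun s => RetractionFiber n s.1
    fiberMul := hA.retractionFiberMul hn
    fiber_nonempty := fun s => let ⟨x, hx⟩ := s.2; ⟨⟨x, hx⟩⟩
    -- The transition map is the retraction `t = e_b` itself: `s ≤ t` means `t ∘ s = t`, so `e_x =
    -- s` gives `e_{t x} = t ∘ e_x = t`.
    map := fun {s t} hst =>
      { toFun := fun x => ⟨t.1 x.1, by
          obtain ⟨_, b, rfl⟩ := t
          have hcomp : iteratedTranslation n b ∘ s.1 = iteratedTranslation n b :=
            congrArg Subtype.val (sup_eq_left.2 hst)
          rw [← x.2] at hcomp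
          exact (hA.iteratedTranslation_comp_eq_iteratedTranslation hn b x.1).symm.trans hcomp⟩
        map_mul' := fun x y => Subtype.ext (by
          obtain ⟨_, b, rfl⟩ := t
          exact hA.iteratedTranslation_mul n b x.1 y.1) }
    map_refl := fun s x => Subtype.ext
      ((congrFun x.2 x.1).symm.trans (hA.iteratedTranslation_self n x.1))
    map_map := fun {s t r} _ htr x => Subtype.ext
      (congrFun (congrArg Subtype.val (sup_eq_left.2 htr)) x.1) }

theorem isLatinSquare_fiber {A : Type u} [Mul A] [Finite A] (hA : IsCIDGroupoid A)
    (hn : IsRetractionExponent A n) (s : Set.range (iteratedTranslation n : A → A → A)) :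
    letI := hA.retractionSemilattice hn
    IsLatinSquare ((hA.plonkaSystem hn).Fiber s) := by
  let _ := hA.retractionSemilattice hn
  intro a b
  have : Finite ((hA.plonkaSystem hn).Fiber s) :=
    inferInstanceAs (Finite (RetractionFiber n s.1))
  have hcomm : ∀ c d : (hA.plonkaSystem hn).Fiber s, c * d = d * c :=
    fun c d => Subtype.ext (hA.comm c.1 d.1)
  have hinj : Function.Injective fun c : (hA.plonkaSystem hn).Fiber s => a * c := by
    intro c d hcd
    have hcd' : a.1 * c.1 = a.1 * d.1 := congrArg Subtype.val hcd
    have hfix : ∀ c : (hA.plonkaSystem hn).Fiber s, iteratedTranslation n a.1 c.1 = c.1 :=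
      fun c => hA.iteratedTranslation_eq_of_mem_fiber (a.2.trans c.2.symm)
    exact Subtype.ext (eq_of_mul_eq_of_iteratedTranslation_eq hn.pos (hfix c) (hfix d) hcd')
  have hexists : ∃! c, a * c = b :=
    Function.Bijective.existsUnique ⟨hinj, Finite.surjective_of_injective hinj⟩ b
  exact ⟨hexists, by simpa only [hcomm _ a] using hexists⟩

/-- A finite commutative idempotent distributive groupoid is the Płonka sum of its fibers. -/
def equivPlonkaSum {A : Type u} [Mul A] [Finite A] (hA : IsCIDGroupoid A)
    (hn : IsRetractionExponent A n) :
    letI := hA.retractionSemilattice hn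
    A ≃* (hA.plonkaSystem hn).Sum :=
  letI := hA.retractionSemilattice hn
  { toFun := fun x => ⟨⟨iteratedTranslation n x, x, rfl⟩, ⟨x, rfl⟩⟩
    invFun := fun x => x.2.1
    left_inv := fun _ => rfl
    right_inv := by
      rintro ⟨⟨s, hs⟩, ⟨x, hx⟩⟩
      obtain rfl : iteratedTranslation n x = s := hx
      rfl
    map_mul' := by
      have hext : ∀ p q : (hA.plonkaSystem hn).Sum, p.2.1 = q.2.1 → p = q := by
        rintro ⟨⟨s, hs⟩, ⟨x, hx⟩⟩ ⟨⟨t, ht⟩, ⟨y, hy⟩⟩ (rfl : x = y)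
        obtain rfl : iteratedTranslation n x = s := hx
        obtain rfl : iteratedTranslation n x = t := hy
        rfl
      intro x y
      refine hext _ _ ?_
      change x * y = (iteratedTranslation n x ∘ iteratedTranslation n y) x *
        (iteratedTranslation n x ∘ iteratedTranslation n y) y
      rw [hA.iteratedTranslation_comp hn, ← hA.iteratedTranslation_mul,
        hA.iteratedTranslation_self] }

end Retraction

end IsCIDGroupoid

theorem theorem7p2 (A : Type u) [Mul A] [Finite A] (hA : IsCIDGroupoid A) :
    IsPlonkaSumOfLatinSquares A := by
  obtain ⟨n, hn⟩ := exists_isRetractionExponent A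
  exact ⟨_, hA.retractionSemilattice hn, hA.plonkaSystem hn, hA.isLatinSquare_fiber hn,
    ⟨hA.equivPlonkaSum hn⟩⟩
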